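/- Let $d\ge 1$, let $\Omega\subset\mathbb R^d$ be a nonempty bounded open set, let $\gamma<0$ and $T>0$. Let $C_2$ be the Poincaré constant of $\Omega$, i.e. the largest $c$ such that $c\int_\Omega v^2\,dx\le\int_\Omega|\nabla v|^2\,dx$ for all $v\in H^1_0(\Omega)$. Let $u$ be a weak solution of $$u_t-\Big(\int_\Omega u^2\,dx\Big)^{\gamma}\Delta u=0\ \text{ in }\Omega\times]0,T],\qquad u=0\ \text{ on }\partial\Omega\times]0,T],\qquad u(\cdot,0)=u_0\ \text{ in }\Omega,$$ that is: $u\in L_2(0,T;H^1(\Omega))$ with $u(\cdot,t)\in H^1_0(\Omega)$ for a.e. $t\in\,]0,T[$; the weak time derivative $u_t$ belongs to $L_2(0,T;L_2(\Omega))$; for a.e. $t\in\,]0,T[$, $$\int_\Omega u_t\,w\,dx+\Big(\int_\Omega u^2\,dx\Big)^{\gamma}\int_\Omega\nabla u\cdot\nabla w\,dx=0\quad\text{for all }w\in H^1_0(\Omega),$$ where the second term is read as $0$ at times with $u(\cdot,t)=0$; and the representative of $u$ in $C([0,T];L_2(\Omega))$, again denoted by $u$, satisfies $u(\cdot,0)=u_0$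 a.e. in $\Omega$. Then $C_2>0$ and, for all $t\in[0,T]$, $$\int_\Omega u^2(x,t)\,dx\le\left[\Big(\int_\Omega u_0^2\,dx\Big)^{|\gamma|}-2|\gamma|C_2\,t\right]_+^{1/|\gamma|},\qquad [h]_+=\max\{h,0\}.$$ In particular $u(\cdot,t)=0$ a.e. in $\Omega$ for every $t\in[0,T]$ with $t\ge\Big(\int_\Omega u_0^2\,dx\Big)^{|\gamma|}/(2|\gamma|C_2)$. -/

import Mathlib

open MeasureTheory Set Filter Topology
open scoped ContDiff

noncomputable section

namespace NonlocalHeat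

/-- The Euclidean space `ℝᵈ`. -/
abbrev E (d : ℕ) : Type := EuclideanSpace ℝ (Fin d)

/-- The Lebesgue space `L²(Ω)` of real functions. -/
abbrev L2 {d : ℕ} (Ω : Set (E d)) : Type := Lp ℝ 2 (volume.restrict Ω)

/-- The Lebesgue space `L²(Ω; ℝᵈ)` of vector fields. -/
abbrev L2Vec {d : ℕ} (Ω : Set (E d)) : Type := Lp (E d) 2 (volume.restrict Ω)

/-- `φ ∈ C_c^∞(Ω)`. -/
structure IsTestFunction {F : Type*} [NormedAddCommGroup F] [NormedSpace ℝ F]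
    (Ω : Set F) (φ : F → ℝ) : Prop where
  contDiff : ContDiff ℝ ∞ φ
  hasCompactSupport : HasCompactSupport φ
  tsupport_subset : tsupport φ ⊆ Ω

theorem IsTestFunction.zero {F : Type*} [NormedAddCommGroup F] [NormedSpace ℝ F]
    (Ω : Set F) : IsTestFunction Ω (fun _ => (0 : ℝ)) where
  contDiff := contDiff_const
  hasCompactSupport := HasCompactSupport.zero
  tsupport_subset := by
    have h : tsupport (fun _ : F => (0 : ℝ)) = ∅ := tsupport_eq_empty_iff.2 rfl
    simp [h]

theorem IsTestFunction.add {F : Type*} [NormedAddCommGroup F] [NormedSpace ℝ F]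
    {Ω : Set F} {φ ψ : F → ℝ} (hφ : IsTestFunction Ω φ) (hψ : IsTestFunction Ω ψ) :
    IsTestFunction Ω (fun x => φ x + ψ x) where
  contDiff := hφ.contDiff.add hψ.contDiff
  hasCompactSupport := hφ.hasCompactSupport.add hψ.hasCompactSupport
  tsupport_subset :=
    (tsupport_add φ ψ).trans (union_subset hφ.tsupport_subset hψ.tsupport_subset)

theorem IsTestFunction.const_mul {F : Type*} [NormedAddCommGroup F] [NormedSpace ℝ F]
    {Ω : Set F} {φ : F → ℝ} (c : ℝ) (hφ : IsTestFunction Ω φ) :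
    IsTestFunction Ω (fun x => c * φ x) where
  contDiff := contDiff_const.mul hφ.contDiff
  hasCompactSupport := hφ.hasCompactSupport.mul_left
  tsupport_subset :=
    (tsupport_mul_subset_right (f := fun _ => c) (g := φ)).trans hφ.tsupport_subset

/-- `g ∈ L²(Ω; ℝᵈ)` is the weak gradient of `v ∈ L²(Ω)`:
`∫_Ω v ∇φ = - ∫_Ω φ g` for every `φ ∈ C_c^∞(Ω)`. -/
def IsWeakGradient {d : ℕ} {Ω : Set (E d)} (v : L2 Ω) (g : L2Vec Ω) : Prop :=
  ∀ φ : E d → ℝ, IsTestFunction Ω φ →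
    ∫ x in Ω, v x • gradient φ x = - ∫ x in Ω, φ x • g x

theorem IsTestFunction.continuous_gradient {d : ℕ} {Ω : Set (E d)} {φ : E d → ℝ}
    (hφ : IsTestFunction Ω φ) : Continuous (gradient φ) :=
  (InnerProductSpace.toDual ℝ (E d)).symm.continuous.comp
    (hφ.contDiff.continuous_fderiv (by simp))

theorem IsTestFunction.hasCompactSupport_gradient {d : ℕ} {Ω : Set (E d)} {φ : E d → ℝ}
    (hφ : IsTestFunction Ω φ) : HasCompactSupport (gradient φ) :=
  (hφ.hasCompactSupport.fderiv ℝ).comp_left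
    (g := (InnerProductSpace.toDual ℝ (E d)).symm) (map_zero _)

theorem integrable_smul_gradient {d : ℕ} {Ω : Set (E d)} (v : L2 Ω) {φ : E d → ℝ}
    (hφ : IsTestFunction Ω φ) :
    Integrable (fun x => v x • gradient φ x) (volume.restrict Ω) :=
  memLp_one_iff_integrable.1 <| MemLp.smul (p := 2) (q := 2) (r := 1)
    ((hφ.continuous_gradient.memLp_of_hasCompactSupport
      hφ.hasCompactSupport_gradient (μ := volume)).restrict Ω) (Lp.memLp v)

theorem integrable_test_smul {d : ℕ} {Ω : Set (E d)} (g : L2Vec Ω) {φ : E d → ℝ}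
    (hφ : IsTestFunction Ω φ) :
    Integrable (fun x => φ x • g x) (volume.restrict Ω) :=
  memLp_one_iff_integrable.1 <| MemLp.smul (p := 2) (q := 2) (r := 1)
    (Lp.memLp g) ((hφ.contDiff.continuous.memLp_of_hasCompactSupport
      hφ.hasCompactSupport (μ := volume)).restrict Ω)

/-- The Sobolev space `H¹(Ω)`, realised as the space of pairs `(v, ∇v)` with `v ∈ L²(Ω)` and
weak gradient `∇v ∈ L²(Ω; ℝᵈ)`, with the norm `(‖v‖² + ‖∇v‖²)^(1/2)`. -/
def H1 {d : ℕ} (Ω : Set (E d)) : Submodule ℝ (WithLp 2 (L2 Ω × L2Vec Ω)) where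
  carrier := {p | IsWeakGradient p.fst p.snd}
  zero_mem' := by
    intro φ _
    have h1 : (fun x => ((0 : WithLp 2 (L2 Ω × L2Vec Ω)).fst : E d → ℝ) x • gradient φ x)
        =ᵐ[volume.restrict Ω] fun _ => 0 := by
      filter_upwards [Lp.coeFn_zero ℝ 2 (volume.restrict Ω)] with x hx
      simp only [WithLp.zero_fst]
      rw [hx]; simp
    have h2 : (fun x => φ x • ((0 : WithLp 2 (L2 Ω × L2Vec Ω)).snd : E d → E d) x)
        =ᵐ[volume.restrict Ω] fun _ => 0 := by
      filter_upwards [Lp.coeFn_zero (E d) 2 (volume.restrict Ω)] with x hx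
      simp only [WithLp.zero_snd]
      rw [hx]; simp
    rw [integral_congr_ae h1, integral_congr_ae h2]
    simp
  add_mem' := by
    intro p q hp hq φ hφ
    have h1 : (fun x => ((p + q).fst : E d → ℝ) x • gradient φ x)
        =ᵐ[volume.restrict Ω] fun x => p.fst x • gradient φ x + q.fst x • gradient φ x := by
      filter_upwards [Lp.coeFn_add p.fst q.fst] with x hx
      simp only [WithLp.add_fst]
      rw [hx]; simp [add_smul]
    have h2 : (fun x => φ x • ((p + q).snd : E d → E d) x)
        =ᵐ[volume.restrict Ω] fun x => φ x • p.snd x + φ x • q.snd x := by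
      filter_upwards [Lp.coeFn_add p.snd q.snd] with x hx
      simp only [WithLp.add_snd]
      rw [hx]; simp [smul_add]
    rw [integral_congr_ae h1, integral_congr_ae h2,
      integral_add (integrable_smul_gradient _ hφ) (integrable_smul_gradient _ hφ),
      integral_add (integrable_test_smul _ hφ) (integrable_test_smul _ hφ), hp φ hφ, hq φ hφ]
    abel
  smul_mem' := by
    intro c p hp φ hφ
    have h1 : (fun x => ((c • p).fst : E d → ℝ) x • gradient φ x)
        =ᵐ[volume.restrict Ω] fun x => c • (p.fst x • gradient φ x) := by
      filter_upwards [Lp.coeFn_smul c p.fst] with x hx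
      simp only [WithLp.smul_fst]
      rw [hx]; simp [mul_smul]
    have h2 : (fun x => φ x • ((c • p).snd : E d → E d) x)
        =ᵐ[volume.restrict Ω] fun x => c • (φ x • p.snd x) := by
      filter_upwards [Lp.coeFn_smul c p.snd] with x hx
      simp only [WithLp.smul_snd]
      rw [hx]; simp [smul_comm c]
    rw [integral_congr_ae h1, integral_congr_ae h2, integral_smul, integral_smul, hp φ hφ]
    simp

/-- The function underlying an element of `H¹(Ω)`. -/
def toL2 {d : ℕ} {Ω : Set (E d)} (v : H1 Ω) : L2 Ω := (v : WithLp 2 (L2 Ω × L2Vec Ω)).fst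

/-- The weak gradient of an element of `H¹(Ω)`. -/
def weakGrad {d : ℕ} {Ω : Set (E d)} (v : H1 Ω) : L2Vec Ω :=
  (v : WithLp 2 (L2 Ω × L2Vec Ω)).snd

/-- The image of `C_c^∞(Ω)` in `H¹(Ω)`. -/
def testSubmodule {d : ℕ} (Ω : Set (E d)) : Submodule ℝ (H1 Ω) where
  carrier := {v | ∃ φ : E d → ℝ, IsTestFunction Ω φ ∧
    toL2 v =ᵐ[volume.restrict Ω] φ ∧ weakGrad v =ᵐ[volume.restrict Ω] gradient φ}
  zero_mem' := by
    refine ⟨fun _ => 0, IsTestFunction.zero Ω, ?_, ?_⟩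
    · exact Lp.coeFn_zero ℝ 2 (volume.restrict Ω)
    · filter_upwards [Lp.coeFn_zero (E d) 2 (volume.restrict Ω)] with x hx
      rw [gradient_fun_const]
      exact hx
  add_mem' := by
    rintro v w ⟨φ, hφ, hv, hv'⟩ ⟨ψ, hψ, hw, hw'⟩
    refine ⟨fun x => φ x + ψ x, hφ.add hψ, ?_, ?_⟩
    · filter_upwards [Lp.coeFn_add (toL2 v) (toL2 w), hv, hw] with x hx h1 h2
      rw [← h1, ← h2]
      exact hx
    · filter_upwards [Lp.coeFn_add (weakGrad v) (weakGrad w), hv', hw'] with x hx h1 h2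
      have h3 : gradient (fun x => φ x + ψ x) x = gradient φ x + gradient ψ x := by
        unfold gradient
        rw [fderiv_fun_add (hφ.contDiff.differentiable (by simp) x)
          (hψ.contDiff.differentiable (by simp) x), map_add]
      rw [h3, ← h1, ← h2]
      exact hx
  smul_mem' := by
    rintro c v ⟨φ, hφ, hv, hv'⟩
    refine ⟨fun x => c * φ x, hφ.const_mul c, ?_, ?_⟩
    · filter_upwards [Lp.coeFn_smul c (toL2 v), hv] with x hx h1
      rw [← h1]
      exact hx
    · filter_upwards [Lp.coeFn_smul c (weakGrad v), hv'] with x hx h1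
      have h3 : gradient (fun x => c * φ x) x = c • gradient φ x := by
        unfold gradient
        rw [fderiv_const_mul (hφ.contDiff.differentiable (by simp) x)]
        simp
      rw [h3, ← h1]
      exact hx

/-- The Sobolev space `H¹₀(Ω)`: the closure of `C_c^∞(Ω)` in `H¹(Ω)`. -/
def H10 {d : ℕ} (Ω : Set (E d)) : Submodule ℝ (H1 Ω) := (testSubmodule Ω).topologicalClosure

/-- The Poincaré constant of `Ω`: the best (largest) constant `c` in the inequality
`c ∫_Ω v² ≤ ∫_Ω |∇v|²`, `v ∈ H¹₀(Ω)`. -/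
def poincareConstant {d : ℕ} (Ω : Set (E d)) : ℝ :=
  sSup {c : ℝ | ∀ v ∈ H10 Ω, c * ∫ x in Ω, (toL2 v x) ^ 2 ≤ ∫ x in Ω, ‖weakGrad v x‖ ^ 2}

/-- `u'` is the weak (distributional) derivative in time of `u : ]0,T[ → L²(Ω)`. -/
def IsWeakTimeDeriv {d : ℕ} {Ω : Set (E d)} (T : ℝ) (u u' : ℝ → L2 Ω) : Prop :=
  ∀ φ : ℝ → ℝ, IsTestFunction (Ioo 0 T) φ →
    ∫ t in Ioo 0 T, deriv φ t • u t = - ∫ t in Ioo 0 T, φ t • u' t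

/-- `ubar` is a representative in `C([0,T]; L²(Ω))` of the class of `u` modulo equality for
almost every `t`. For `T > 0` the values of `ubar` on `[0,T]` are determined by `u`. -/
structure IsContinuousRepresentative {d : ℕ} {Ω : Set (E d)} (T : ℝ) (u : ℝ → H1 Ω)
    (ubar : ℝ → L2 Ω) : Prop where
  continuousOn : ContinuousOn ubar (Icc 0 T)
  ae_eq : ∀ᵐ t ∂(volume.restrict (Ioo 0 T)), ubar t = toL2 (u t)

/-- `u` is a weak solution on `Ω × ]0,T]` of
`u_t - (∫_Ω u² dx)^γ Δu = f`, `u = 0` on `∂Ω × ]0,T]`, `u(·,0) = u₀`.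

At a time with `∫_Ω u² dx = 0` the (finite) value that Lean gives to `0 ^ γ` is irrelevant,
because then `u(t) = 0` and so `∇u(t) = 0`: the diffusion term is zero. -/
structure IsWeakSolution {d : ℕ} (Ω : Set (E d)) (γ T : ℝ) (f : ℝ → L2 Ω) (u₀ : E d → ℝ)
    (u : ℝ → H1 Ω) : Prop where
  /-- `u ∈ L²(0,T; H¹(Ω))` -/
  memLp : MemLp u 2 (volume.restrict (Ioo 0 T))
  /-- `u = 0` on `∂Ω`, for almost every `t` -/
  boundary : ∀ᵐ t ∂(volume.restrict (Ioo 0 T)), u t ∈ H10 Ω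
  /-- `u_t ∈ L²(0,T; L²(Ω))`, and the integral identity for all `w ∈ H¹₀(Ω)` -/
  equation : ∃ u' : ℝ → L2 Ω, MemLp u' 2 (volume.restrict (Ioo 0 T)) ∧
    IsWeakTimeDeriv T (fun t => toL2 (u t)) u' ∧
    ∀ᵐ t ∂(volume.restrict (Ioo 0 T)), ∀ w ∈ H10 Ω,
      (∫ x in Ω, u' t x * toL2 w x) +
        (∫ x in Ω, (toL2 (u t) x) ^ 2) ^ γ * ∫ x in Ω, inner ℝ (weakGrad (u t) x) (weakGrad w x) =
      ∫ x in Ω, f t x * toL2 w x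
  /-- `u(x,0) = u₀(x)`, for the representative in `C([0,T]; L²(Ω))` -/
  initial : ∃ ubar : ℝ → L2 Ω, IsContinuousRepresentative T u ubar ∧
    ubar 0 =ᵐ[volume.restrict Ω] u₀

end NonlocalHeat

end

namespace NonlocalHeat

variable {d : ℕ} {Ω : Set (E d)}

/-! This is an energy argument. Put y(t) = ‖ubar t‖². Testing the equation with u(t) itself and
applying the Poincaré inequality gives y' ≤ -2 C₂ y^(γ+1) for a.e. t. As long as y > 0 this says
(y^|γ|)' ≤ -2|γ|C₂, so y^|γ| lies below a line that reaches zero in finite time.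

Three points need care. The Poincaré constant is a real supremum, so it has a meaning only if its
set of admissible constants is nonempty and bounded above: `exists_pos_poincare` uses that Ω is
bounded, `bddAbove_poincare` that Ω is open and nonempty. The time derivative is only
distributional: `eq_add_integral_of_weak_deriv` shows that the continuous representative is the
primitive of u_t, so y is absolutely continuous with y' = 2⟨ubar, u_t⟩ a.e. Finally, the power y^|γ|
need not be Lipschitz in y near y = 0; `le_of_deriv_le_neg_rpow` fixes a time t with y(t) > 0 and
uses monotonicity to stay away from zero on [0,t]. -/

theorem integral_norm_sq_eq_norm_sq {F : Type*} [NormedAddCommGroup F] [InnerProductSpace ℝ F]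
    {X : Type*} [MeasurableSpace X] {μ : Measure X} (f : Lp F 2 μ) :
    ∫ x, ‖f x‖ ^ 2 ∂μ = ‖f‖ ^ 2 := by
  rw [← real_inner_self_eq_norm_sq, L2.inner_def]
  simp only [real_inner_self_eq_norm_sq]

theorem integral_sq_eq_norm_sq {X : Type*} [MeasurableSpace X] {μ : Measure X} (f : Lp ℝ 2 μ) :
    ∫ x, f x ^ 2 ∂μ = ‖f‖ ^ 2 := by
  rw [← integral_norm_sq_eq_norm_sq]
  simp

/-! ### Poincaré inequality in a set bounded in one direction -/

theorem inner_gradient_eq_fderiv (φ : E d → ℝ) (x v : E d) :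
    inner ℝ (gradient φ x) v = fderiv ℝ φ x v := by
  simp [gradient]

theorem IsTestFunction.eq_zero_of_notMem {φ : E d → ℝ} (hφ : IsTestFunction Ω φ) {x : E d}
    (hx : x ∉ Ω) : φ x = 0 :=
  image_eq_zero_of_notMem_tsupport fun h => hx (hφ.tsupport_subset h)

theorem IsTestFunction.gradient_eq_zero_of_notMem {φ : E d → ℝ} (hφ : IsTestFunction Ω φ)
    {x : E d} (hx : x ∉ Ω) : gradient φ x = 0 := by
  have h : fderiv ℝ φ x = 0 := by
    by_contra h
    exact hx (hφ.tsupport_subset (support_fderiv_subset ℝ h))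
  simp [gradient, h]

theorem IsTestFunction.differentiable {φ : E d → ℝ} (hφ : IsTestFunction Ω φ) :
    Differentiable ℝ φ :=
  hφ.contDiff.differentiable (by simp)

/-- The Poincaré inequality for test functions on a set that is bounded in one direction. -/
theorem IsTestFunction.poincare {φ : E d → ℝ} (hφ : IsTestFunction Ω φ) (ℓ : E d →L[ℝ] ℝ)
    {v : E d} (hvn : ‖v‖ = 1) (hℓv : ℓ v = 1) {R : ℝ} (hR : ∀ x ∈ Ω, |ℓ x| ≤ R) :
    ∫ x in Ω, φ x ^ 2 ≤ 4 * R ^ 2 * ∫ x in Ω, ‖gradient φ x‖ ^ 2 := by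
  have hcs : HasCompactSupport (fun x => φ x ^ 2) :=
    hφ.hasCompactSupport.comp_left (g := fun r : ℝ => r ^ 2) (by simp)
  have hc : Continuous φ := hφ.contDiff.continuous
  have hg : Continuous (gradient φ) := hφ.continuous_gradient
  have hfd : ∀ x, fderiv ℝ (fun y => φ y ^ 2) x v = 2 * φ x * inner ℝ (gradient φ x) v := by
    intro x
    rw [inner_gradient_eq_fderiv, fderiv_fun_pow 2 (hφ.differentiable x)]
    simp
  have hsq : Integrable (fun x => φ x ^ 2) :=
    (hc.pow 2).integrable_of_hasCompactSupport hcs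
  have hgcs : HasCompactSupport (fun x => ‖gradient φ x‖ ^ 2) :=
    hφ.hasCompactSupport_gradient.comp_left (g := fun z : E d => ‖z‖ ^ 2)
      (by rw [norm_zero, zero_pow two_ne_zero])
  have hgsq : Integrable (fun x => ‖gradient φ x‖ ^ 2) :=
    (hg.norm.pow 2).integrable_of_hasCompactSupport hgcs
  have hcross : Integrable (fun x => (2 * φ x * inner ℝ (gradient φ x) v) * ℓ x) :=
    (((continuous_const.mul hc).mul (hg.inner continuous_const)).mul
      ℓ.continuous).integrable_of_hasCompactSupport
      (hφ.hasCompactSupport.mul_left (f := fun _ => 2)).mul_right.mul_right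
  -- Since `ℓ` has derivative 1 in the direction `v`, write φ² = φ² ∂ᵥℓ and integrate by parts.
  have key : ∫ x, φ x ^ 2 = - ∫ x, (2 * φ x * inner ℝ (gradient φ x) v) * ℓ x := by
    have := integral_mul_fderiv_eq_neg_fderiv_mul_of_integrable (μ := (volume : Measure (E d)))
      (f := fun y => φ y ^ 2) (g := ℓ) (v := v) (by simpa only [hfd] using hcross)
      (by simpa [hℓv] using hsq)
      (((hc.pow 2).mul ℓ.continuous).integrable_of_hasCompactSupport hcs.mul_right)
      (fun x _ => (hφ.differentiable x).pow 2) (fun x _ => ℓ.differentiableAt)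
    simpa [hfd, hℓv] using this
  have hpt : ∀ x, -((2 * φ x * inner ℝ (gradient φ x) v) * ℓ x)
      ≤ 1 / 2 * φ x ^ 2 + 2 * R ^ 2 * ‖gradient φ x‖ ^ 2 := by
    intro x
    by_cases hx : x ∈ Ω
    · have h1 : |inner ℝ (gradient φ x) v * ℓ x| ≤ ‖gradient φ x‖ * R := by
        rw [abs_mul]
        refine mul_le_mul ?_ (hR x hx) (abs_nonneg _) (norm_nonneg _)
        simpa [hvn] using abs_real_inner_le_norm (gradient φ x) v
      have h2 : (inner ℝ (gradient φ x) v * ℓ x) ^ 2 ≤ (‖gradient φ x‖ * R) ^ 2 :=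
        sq_le_sq' (abs_le.1 h1).1 (abs_le.1 h1).2
      -- Young's inequality, weighted so that only half of φ² appears on the right; `hle` then
      -- absorbs it, which produces the constant 4R².
      have h3 := sq_nonneg (φ x + 2 * (inner ℝ (gradient φ x) v * ℓ x))
      generalize inner ℝ (gradient φ x) v = b at h2 h3 ⊢
      generalize φ x = a at h3 ⊢
      generalize ℓ x = l at h2 h3 ⊢
      generalize ‖gradient φ x‖ = n at h2 ⊢
      linarith
    · rw [hφ.eq_zero_of_notMem hx]
      have : 0 ≤ 2 * R ^ 2 * ‖gradient φ x‖ ^ 2 := by positivity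
      simpa using this
  have hle : ∫ x, φ x ^ 2 ≤ 1 / 2 * (∫ x, φ x ^ 2) + 2 * R ^ 2 * ∫ x, ‖gradient φ x‖ ^ 2 := by
    calc ∫ x, φ x ^ 2 = ∫ x, -((2 * φ x * inner ℝ (gradient φ x) v) * ℓ x) := by
          rw [key, integral_neg]
      _ ≤ ∫ x, (1 / 2 * φ x ^ 2 + 2 * R ^ 2 * ‖gradient φ x‖ ^ 2) :=
          integral_mono hcross.neg ((hsq.const_mul _).add (hgsq.const_mul _)) hpt
      _ = _ := by
          rw [integral_add (hsq.const_mul _) (hgsq.const_mul _), integral_const_mul,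
            integral_const_mul]
  rw [setIntegral_eq_integral_of_forall_compl_eq_zero
      (fun x hx => by simp [hφ.eq_zero_of_notMem hx]),
    setIntegral_eq_integral_of_forall_compl_eq_zero
      (fun x hx => by simp [hφ.gradient_eq_zero_of_notMem hx])]
  linarith

theorem continuous_toL2 : Continuous (toL2 : H1 Ω → L2 Ω) := by
  unfold toL2; fun_prop

theorem continuous_weakGrad : Continuous (weakGrad : H1 Ω → L2Vec Ω) := by
  unfold weakGrad; fun_prop

/-- The Poincaré inequality on `H¹₀(Ω)`, for `Ω` bounded in one direction. -/
theorem integral_sq_le_of_mem_H10 (ℓ : E d →L[ℝ] ℝ) {e : E d} (he : ‖e‖ = 1) (hℓe : ℓ e = 1)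
    {R : ℝ} (hR : ∀ x ∈ Ω, |ℓ x| ≤ R) {v : H1 Ω} (hv : v ∈ H10 Ω) :
    ∫ x in Ω, toL2 v x ^ 2 ≤ 4 * R ^ 2 * ∫ x in Ω, ‖weakGrad v x‖ ^ 2 := by
  have hclosed : IsClosed {w : H1 Ω | ‖toL2 w‖ ^ 2 ≤ 4 * R ^ 2 * ‖weakGrad w‖ ^ 2} :=
    isClosed_le (continuous_toL2.norm.pow 2) (continuous_const.mul (continuous_weakGrad.norm.pow 2))
  have hsub : (testSubmodule Ω : Set (H1 Ω)) ⊆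
      {w : H1 Ω | ‖toL2 w‖ ^ 2 ≤ 4 * R ^ 2 * ‖weakGrad w‖ ^ 2} := by
    rintro w ⟨φ, hφ, h1, h2⟩
    have h := hφ.poincare ℓ he hℓe hR
    rw [mem_ofPred_eq, ← integral_sq_eq_norm_sq, ← integral_norm_sq_eq_norm_sq,
      integral_congr_ae (h1.mono fun x hx => congrArg (· ^ 2) hx),
      integral_congr_ae (h2.mono fun x hx => congrArg (‖·‖ ^ 2) hx)]
    exact h
  rw [integral_sq_eq_norm_sq, integral_norm_sq_eq_norm_sq]
  exact closure_minimal hsub hclosed hv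

/-! ### The Poincaré constant -/

theorem IsTestFunction.integral_smul_gradient {φ ψ : E d → ℝ} (hφ : IsTestFunction Ω φ)
    (hψ : IsTestFunction Ω ψ) :
    ∫ x in Ω, φ x • gradient ψ x = - ∫ x in Ω, ψ x • gradient φ x := by
  have hcφ : Continuous φ := hφ.contDiff.continuous
  have hcψ : Continuous ψ := hψ.contDiff.continuous
  have hgφ := hφ.continuous_gradient
  have hgψ := hψ.continuous_gradient
  have i1 : Integrable (fun x => φ x • gradient ψ x) :=
    (hcφ.smul hgψ).integrable_of_hasCompactSupport hφ.hasCompactSupport.smul_right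
  have i2 : Integrable (fun x => ψ x • gradient φ x) :=
    (hcψ.smul hgφ).integrable_of_hasCompactSupport hψ.hasCompactSupport.smul_right
  rw [setIntegral_eq_integral_of_forall_compl_eq_zero
      (fun x hx => by simp [hφ.eq_zero_of_notMem hx]),
    setIntegral_eq_integral_of_forall_compl_eq_zero
      (fun x hx => by simp [hψ.eq_zero_of_notMem hx])]
  refine ext_inner_left ℝ fun w => ?_
  have e1 : ∀ x, inner ℝ w (φ x • gradient ψ x) = φ x * fderiv ℝ ψ x w := fun x => by
    rw [inner_smul_right, real_inner_comm, inner_gradient_eq_fderiv]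
  have e2 : ∀ x, inner ℝ w (ψ x • gradient φ x) = fderiv ℝ φ x w * ψ x := fun x => by
    rw [inner_smul_right, real_inner_comm, inner_gradient_eq_fderiv, mul_comm]
  rw [inner_neg_right, ← integral_inner i1, ← integral_inner i2]
  simp only [e1, e2]
  refine integral_mul_fderiv_eq_neg_fderiv_mul_of_integrable ?_ ?_ ?_
    (fun x _ => hφ.differentiable x) (fun x _ => hψ.differentiable x)
  · simpa only [e2] using i2.const_inner (𝕜 := ℝ) w
  · simpa only [e1] using i1.const_inner (𝕜 := ℝ) w
  · exact (hcφ.mul hcψ).integrable_of_hasCompactSupport hφ.hasCompactSupport.mul_right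

theorem IsTestFunction.exists_mem_H10 {φ : E d → ℝ} (hφ : IsTestFunction Ω φ) :
    ∃ v ∈ H10 Ω, toL2 v =ᵐ[volume.restrict Ω] φ := by
  have m1 : MemLp φ 2 (volume.restrict Ω) :=
    (hφ.contDiff.continuous.memLp_of_hasCompactSupport hφ.hasCompactSupport
      (μ := volume)).restrict Ω
  have m2 : MemLp (gradient φ) 2 (volume.restrict Ω) :=
    (hφ.continuous_gradient.memLp_of_hasCompactSupport hφ.hasCompactSupport_gradient
      (μ := volume)).restrict Ω
  have hw : IsWeakGradient (m1.toLp φ) (m2.toLp (gradient φ)) := by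
    intro ψ hψ
    have h1 : (fun x => m1.toLp φ x • gradient ψ x) =ᵐ[volume.restrict Ω]
        fun x => φ x • gradient ψ x := by
      filter_upwards [m1.coeFn_toLp] with x hx
      rw [hx]
    have h2 : (fun x => ψ x • m2.toLp (gradient φ) x) =ᵐ[volume.restrict Ω]
        fun x => ψ x • gradient φ x := by
      filter_upwards [m2.coeFn_toLp] with x hx
      rw [hx]
    rw [integral_congr_ae h1, integral_congr_ae h2]
    exact hφ.integral_smul_gradient hψ
  exact ⟨⟨WithLp.toLp 2 (m1.toLp φ, m2.toLp (gradient φ)), hw⟩,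
    Submodule.le_topologicalClosure _ ⟨φ, hφ, m1.coeFn_toLp, m2.coeFn_toLp⟩, m1.coeFn_toLp⟩

theorem exists_mem_H10_integral_sq_pos (hΩ : IsOpen Ω) (hΩn : Ω.Nonempty) :
    ∃ v ∈ H10 Ω, 0 < ∫ x in Ω, toL2 v x ^ 2 := by
  obtain ⟨x₀, hx₀⟩ := hΩn
  obtain ⟨φ, hs, hc, hd, -, h1⟩ :=
    exists_contDiff_tsupport_subset (n := ⊤) (hΩ.mem_nhds hx₀)
  have hφ : IsTestFunction Ω φ := ⟨hd, hc, hs⟩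
  obtain ⟨v, hv, hvφ⟩ := hφ.exists_mem_H10
  refine ⟨v, hv, ?_⟩
  rw [integral_congr_ae (hvφ.mono fun x hx => congrArg (· ^ 2) hx),
    setIntegral_eq_integral_of_forall_compl_eq_zero
      (fun x hx => by simp [hφ.eq_zero_of_notMem hx])]
  exact (hd.continuous.pow 2).integral_pos_of_hasCompactSupport_nonneg_nonzero
    (hc.comp_left (g := fun r : ℝ => r ^ 2) (by simp))
    (fun x => sq_nonneg _) (x := x₀) (by simp [h1])

/-- The Rayleigh quotient of one nonzero bump function bounds every admissible constant. Without
this bound the real `sSup` would take its default value 0. -/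
theorem bddAbove_poincare (hΩ : IsOpen Ω) (hΩn : Ω.Nonempty) :
    BddAbove {c : ℝ | ∀ v ∈ H10 Ω,
      c * ∫ x in Ω, (toL2 v x) ^ 2 ≤ ∫ x in Ω, ‖weakGrad v x‖ ^ 2} := by
  obtain ⟨v, hv, hpos⟩ := exists_mem_H10_integral_sq_pos hΩ hΩn
  exact ⟨_, fun c hc => (le_div_iff₀ hpos).2 (hc v hv)⟩

theorem exists_pos_poincare (hd : 1 ≤ d) (hΩb : Bornology.IsBounded Ω) :
    ∃ c : ℝ, 0 < c ∧ ∀ v ∈ H10 Ω,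
      c * ∫ x in Ω, (toL2 v x) ^ 2 ≤ ∫ x in Ω, ‖weakGrad v x‖ ^ 2 := by
  obtain ⟨R, hRpos, hR⟩ := hΩb.exists_pos_norm_le
  refine ⟨(4 * R ^ 2)⁻¹, by positivity, fun v hv => ?_⟩
  have h := integral_sq_le_of_mem_H10 (EuclideanSpace.proj ⟨0, hd⟩)
    (e := EuclideanSpace.single ⟨0, hd⟩ 1) (by simp) (by simp)
    (fun x hx => (PiLp.norm_apply_le x ⟨0, hd⟩).trans (hR x hx)) hv
  rwa [inv_mul_le_iff₀ (by positivity)]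

theorem poincareConstant_pos (hd : 1 ≤ d) (hΩ : IsOpen Ω) (hΩb : Bornology.IsBounded Ω)
    (hΩn : Ω.Nonempty) : 0 < poincareConstant Ω := by
  obtain ⟨c, hc, h⟩ := exists_pos_poincare hd hΩb
  exact hc.trans_le (le_csSup (bddAbove_poincare hΩ hΩn) h)

/-- The supremum is itself admissible: for fixed `v` with nonzero norm, each admissible constant is
at most the Rayleigh quotient of `v`, hence so is their supremum. -/
theorem poincareConstant_mul_le (hd : 1 ≤ d) (hΩb : Bornology.IsBounded Ω) {v : H1 Ω}
    (hv : v ∈ H10 Ω) :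
    poincareConstant Ω * ∫ x in Ω, (toL2 v x) ^ 2 ≤ ∫ x in Ω, ‖weakGrad v x‖ ^ 2 := by
  have h0 : 0 ≤ ∫ x in Ω, (toL2 v x) ^ 2 := integral_nonneg fun x => sq_nonneg _
  rcases h0.eq_or_lt with h | h
  · rw [← h, mul_zero]
    exact integral_nonneg fun x => by positivity
  · rw [← le_div_iff₀ h]
    obtain ⟨c, -, hc⟩ := exists_pos_poincare hd hΩb
    exact csSup_le ⟨c, hc⟩ fun c hc => (le_div_iff₀ h).2 (hc v hv)

/-! ### Absolute continuity by comparison -/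

/-- Serves twice: for `‖v‖`, compared with the primitive of `‖w‖`, and for a power of `y`, Lipschitz
on the range of `y`. -/
theorem _root_.AbsolutelyContinuousOnInterval.of_dist_le {X Y : Type*} [PseudoMetricSpace X]
    [PseudoMetricSpace Y] {f : ℝ → X} {g : ℝ → Y} {a b K : ℝ}
    (hg : AbsolutelyContinuousOnInterval g a b)
    (h : ∀ x ∈ uIcc a b, ∀ y ∈ uIcc a b, dist (f x) (f y) ≤ K * dist (g x) (g y)) :
    AbsolutelyContinuousOnInterval f a b := by
  have hK : Tendsto (fun I : ℕ × (ℕ → ℝ × ℝ) =>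
      K * ∑ i ∈ Finset.range I.1, dist (g (I.2 i).1) (g (I.2 i).2))
      (AbsolutelyContinuousOnInterval.totalLengthFilter ⊓
        𝓟 (AbsolutelyContinuousOnInterval.disjWithin a b)) (𝓝 0) := by
    simpa using Tendsto.const_mul K hg
  refine squeeze_zero' (Eventually.of_forall fun I => Finset.sum_nonneg fun i _ => dist_nonneg)
    ?_ hK
  have hmem : ∀ᶠ I in AbsolutelyContinuousOnInterval.totalLengthFilter ⊓
      𝓟 (AbsolutelyContinuousOnInterval.disjWithin a b),
      I ∈ AbsolutelyContinuousOnInterval.disjWithin a b :=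
    mem_inf_of_right (mem_principal_self _)
  filter_upwards [hmem] with I hI
  rw [Finset.mul_sum]
  exact Finset.sum_le_sum fun i hi => h _ (hI.1 i hi).1 _ (hI.1 i hi).2

/-! ### Smooth steps in time -/

theorem deriv_smoothTransition_nonneg (x : ℝ) : 0 ≤ deriv Real.smoothTransition x :=
  Real.smoothTransition.monotone.deriv_nonneg

theorem deriv_smoothTransition_of_nonpos {x : ℝ} (hx : x ≤ 0) :
    deriv Real.smoothTransition x = 0 := by
  have : IsLocalMin Real.smoothTransition x := Eventually.of_forall fun y => by
    rw [Real.smoothTransition.zero_of_nonpos hx]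
    exact Real.smoothTransition.nonneg y
  exact this.deriv_eq_zero

theorem deriv_smoothTransition_of_one_le {x : ℝ} (hx : 1 ≤ x) :
    deriv Real.smoothTransition x = 0 := by
  have : IsLocalMax Real.smoothTransition x := Eventually.of_forall fun y => by
    rw [Real.smoothTransition.one_of_one_le hx]
    exact Real.smoothTransition.le_one y
  exact this.deriv_eq_zero

/-- A smooth step of width `k⁻¹` starting at `s`. -/
noncomputable def smoothStep (s k x : ℝ) : ℝ := Real.smoothTransition (k * (x - s))

theorem contDiff_smoothStep (s k : ℝ) : ContDiff ℝ ∞ (smoothStep s k) :=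
  Real.smoothTransition.contDiff.comp (contDiff_const.mul (contDiff_id.sub contDiff_const))

theorem deriv_smoothStep (s k x : ℝ) :
    deriv (smoothStep s k) x = k * deriv Real.smoothTransition (k * (x - s)) := by
  have h1 : HasDerivAt (fun x : ℝ => k * (x - s)) k x := by
    simpa using ((hasDerivAt_id x).sub_const s).const_mul k
  have h2 : HasDerivAt Real.smoothTransition (deriv Real.smoothTransition (k * (x - s)))
      (k * (x - s)) :=
    ((Real.smoothTransition.contDiff (n := 1)).differentiable (by simp) _).hasDerivAt
  rw [mul_comm k (deriv _ _)]
  exact (h2.comp x h1).deriv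

theorem continuous_deriv_smoothStep (s k : ℝ) : Continuous (deriv (smoothStep s k)) :=
  (contDiff_smoothStep s k).continuous_deriv (by simp)

theorem smoothStep_nonneg (s k x : ℝ) : 0 ≤ smoothStep s k x := Real.smoothTransition.nonneg _

theorem smoothStep_le_one (s k x : ℝ) : smoothStep s k x ≤ 1 := Real.smoothTransition.le_one _

theorem smoothStep_of_le {s k x : ℝ} (hk : 0 ≤ k) (hx : x ≤ s) : smoothStep s k x = 0 :=
  Real.smoothTransition.zero_of_nonpos (mul_nonpos_of_nonneg_of_nonpos hk (by linarith))

theorem smoothStep_of_ge {s k x : ℝ} (hx : 1 ≤ k * (x - s)) : smoothStep s k x = 1 :=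
  Real.smoothTransition.one_of_one_le hx

theorem eventually_one_le_mul {c : ℝ} (hc : 0 < c) : ∀ᶠ k : ℝ in atTop, 1 ≤ k * c :=
  (tendsto_id.atTop_mul_const hc).eventually_ge_atTop 1

theorem tendsto_smoothStep (s x : ℝ) :
    Tendsto (fun k => smoothStep s k x) atTop (𝓝 ((Ioi s).indicator 1 x)) := by
  refine tendsto_nhds_of_eventually_eq ?_
  by_cases hx : s < x
  · filter_upwards [eventually_one_le_mul (sub_pos.2 hx)] with k hk
    rw [smoothStep_of_ge hk, indicator_of_mem (mem_Ioi.2 hx), Pi.one_apply]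
  · filter_upwards [eventually_ge_atTop 0] with k hk
    rw [smoothStep_of_le hk (not_lt.1 hx), indicator_of_notMem (by simpa using hx)]

/-- The derivatives of the smooth steps starting at `s` are an approximate identity at `s`. -/
theorem tendsto_integral_deriv_smoothStep {H : Type*} [NormedAddCommGroup H] [NormedSpace ℝ H]
    [CompleteSpace H] {T s : ℝ} (hs : s ∈ Ioo 0 T) {v : ℝ → H} (hv : ContinuousOn v (Icc 0 T)) :
    Tendsto (fun k => ∫ x in Ioo 0 T, deriv (smoothStep s k) x • v x) atTop (𝓝 (v s)) := by
  have hsub : Ioo 0 T ⊆ Icc 0 T := Ioo_subset_Icc_self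
  have hT : 0 < T := hs.1.trans hs.2
  refine tendsto_setIntegral_peak_smul_of_integrableOn_of_tendsto (x₀ := s) measurableSet_Ioo
    measurableSet_Ioo subset_rfl self_mem_nhdsWithin (by simp) ?_ ?_ ?_ ?_ ?_ ?_
  · filter_upwards [eventually_ge_atTop 0] with k hk x _
    rw [deriv_smoothStep]
    exact mul_nonneg hk (deriv_smoothTransition_nonneg _)
  · intro U hU hsU
    obtain ⟨δ, hδ, hball⟩ := Metric.isOpen_iff.1 hU s hsU
    rw [Metric.tendstoUniformlyOn_iff]
    intro ε hε
    filter_upwards [eventually_one_le_mul hδ, eventually_ge_atTop 0] with k hk hk0 x hx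
    have hx' : δ ≤ |x - s| := by
      by_contra h
      exact hx.2 (hball (by simpa [Real.dist_eq] using h))
    have : deriv (smoothStep s k) x = 0 := by
      rw [deriv_smoothStep]
      rcases le_abs'.1 hx' with h | h
      · rw [deriv_smoothTransition_of_nonpos (mul_nonpos_of_nonneg_of_nonpos hk0 (by linarith)),
          mul_zero]
      · rw [deriv_smoothTransition_of_one_le (hk.trans (mul_le_mul_of_nonneg_left h hk0)),
          mul_zero]
    simpa [this] using hε
  · refine tendsto_nhds_of_eventually_eq ?_
    filter_upwards [eventually_one_le_mul (sub_pos.2 hs.2), eventually_ge_atTop 0] with k hk hk0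
    rw [← integral_Ioc_eq_integral_Ioo, ← intervalIntegral.integral_of_le hT.le,
      intervalIntegral.integral_deriv_eq_sub
        (fun x _ => (contDiff_smoothStep s k).differentiable (by simp) x)
        ((continuous_deriv_smoothStep s k).intervalIntegrable _ _),
      smoothStep_of_ge hk, smoothStep_of_le hk0 hs.1.le, sub_zero]
  · exact Eventually.of_forall fun k => (continuous_deriv_smoothStep s k).aestronglyMeasurable
  · exact (hv.integrableOn_compact isCompact_Icc).mono_set hsub
  · exact (hv s (hsub hs)).mono_left (nhdsWithin_mono s hsub)

/-- A smooth plateau between `s` and `t`. The lower bound on `k` completes the second step before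
the midpoint of `t` and `T`, which keeps the support inside ]0,T[. -/
theorem isTestFunction_smoothStep_sub {T s t k : ℝ} (hs : 0 < s) (hst : s ≤ t)
    (hk0 : 0 < k) (hk : 1 ≤ k * ((T - t) / 2)) (htT : t < T) :
    IsTestFunction (Ioo 0 T) (fun x => smoothStep s k x - smoothStep t k x) := by
  have hsupp : tsupport (fun x => smoothStep s k x - smoothStep t k x) ⊆ Icc s ((t + T) / 2) := by
    refine closure_minimal (fun x hx => ?_) isClosed_Icc
    by_contra h
    refine hx ?_
    rcases not_and_or.1 h with h | h
    · have h : x ≤ s := (not_le.1 h).le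
      simp only [smoothStep_of_le hk0.le h, smoothStep_of_le hk0.le (h.trans hst), sub_zero]
    · have h : (T - t) / 2 ≤ x - t := by linarith [not_le.1 h]
      have h1 : 1 ≤ k * (x - t) := hk.trans (mul_le_mul_of_nonneg_left h hk0.le)
      have h2 : 1 ≤ k * (x - s) :=
        h1.trans (mul_le_mul_of_nonneg_left (by linarith) hk0.le)
      simp only [smoothStep_of_ge h1, smoothStep_of_ge h2, sub_self]
  exact
    { contDiff := (contDiff_smoothStep s k).sub (contDiff_smoothStep t k)
      hasCompactSupport := isCompact_Icc.of_isClosed_subset (isClosed_tsupport _) hsupp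
      tsupport_subset := hsupp.trans (Icc_subset_Ioo hs (by linarith)) }

/-! ### From the weak time derivative to a primitive -/

section WeakDerivative

variable {H : Type*} [NormedAddCommGroup H] [NormedSpace ℝ H] [CompleteSpace H] {T : ℝ}
  {v w : ℝ → H}

/-- Test with the difference of the steps at `s` and `t` and let `k → ∞`: its derivative
concentrates to δₛ - δₜ, while the function itself tends to the indicator of ]s,t]. -/
theorem sub_eq_integral_of_weak_deriv_of_mem_Ioo (hv : ContinuousOn v (Icc 0 T))
    (hw : IntegrableOn w (Ioo 0 T))
    (h : ∀ φ : ℝ → ℝ, IsTestFunction (Ioo 0 T) φ →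
      ∫ t in Ioo 0 T, deriv φ t • v t = - ∫ t in Ioo 0 T, φ t • w t)
    {s t : ℝ} (hs : 0 < s) (hst : s ≤ t) (ht : t < T) :
    v t - v s = ∫ x in s..t, w x := by
  have hint : ∀ r k : ℝ, IntegrableOn (fun x => deriv (smoothStep r k) x • v x) (Ioo 0 T) :=
    fun r k => (((continuous_deriv_smoothStep r k).continuousOn.smul hv).integrableOn_compact
      isCompact_Icc).mono_set Ioo_subset_Icc_self
  have h1 : Tendsto (fun k => ∫ x in Ioo 0 T,
      deriv (fun x => smoothStep s k x - smoothStep t k x) x • v x) atTop (𝓝 (v s - v t)) := by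
    refine ((tendsto_integral_deriv_smoothStep ⟨hs, hst.trans_lt ht⟩ hv).sub
      (tendsto_integral_deriv_smoothStep ⟨hs.trans_le hst, ht⟩ hv)).congr fun k => ?_
    rw [← integral_sub (hint s k) (hint t k)]
    congr 1 with x
    rw [deriv_fun_sub ((contDiff_smoothStep s k).differentiable (by simp) x)
      ((contDiff_smoothStep t k).differentiable (by simp) x), sub_smul]
  have h2 : Tendsto (fun k => ∫ x in Ioo 0 T, (smoothStep s k x - smoothStep t k x) • w x) atTop
      (𝓝 (∫ x in Ioo 0 T, (Ioc s t).indicator w x)) := by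
    refine tendsto_integral_filter_of_dominated_convergence (fun x => ‖w x‖) ?_ ?_ hw.norm ?_
    · exact Eventually.of_forall fun k => (((contDiff_smoothStep s k).continuous.sub
        (contDiff_smoothStep t k).continuous).aestronglyMeasurable).smul hw.aestronglyMeasurable
    · refine Eventually.of_forall fun k => ae_of_all _ fun x => ?_
      rw [norm_smul]
      refine mul_le_of_le_one_left (norm_nonneg _) (abs_le.2 ⟨?_, ?_⟩)
      · linarith [smoothStep_nonneg s k x, smoothStep_le_one t k x]
      · linarith [smoothStep_nonneg t k x, smoothStep_le_one s k x]
    · refine ae_of_all _ fun x => ?_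
      convert ((tendsto_smoothStep s x).sub (tendsto_smoothStep t x)).smul_const (w x) using 2
      by_cases hx1 : s < x <;> by_cases hx2 : t < x <;>
        simp [indicator, hx1, hx2, not_le.2, not_lt.1]
      exact absurd (hst.trans_lt hx2) hx1
  have h3 : ∫ x in Ioo 0 T, (Ioc s t).indicator w x = ∫ x in s..t, w x := by
    rw [setIntegral_indicator measurableSet_Ioc,
      inter_eq_right.2 (Ioc_subset_Icc_self.trans (Icc_subset_Ioo hs ht)),
      intervalIntegral.integral_of_le hst]
  rw [h3] at h2
  have h4 : Tendsto (fun k => ∫ x in Ioo 0 T,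
      deriv (fun x => smoothStep s k x - smoothStep t k x) x • v x) atTop
      (𝓝 (-∫ x in s..t, w x)) := by
    refine h2.neg.congr' ?_
    filter_upwards [eventually_one_le_mul (c := (T - t) / 2) (by linarith),
      eventually_gt_atTop 0] with k hk hk0
    exact (h _ (isTestFunction_smoothStep_sub hs hst hk0 hk ht)).symm
  rw [← neg_sub, tendsto_nhds_unique h1 h4, neg_neg]

theorem eq_add_integral_of_weak_deriv (hT : 0 < T) (hv : ContinuousOn v (Icc 0 T))
    (hw : IntervalIntegrable w volume 0 T)
    (h : ∀ φ : ℝ → ℝ, IsTestFunction (Ioo 0 T) φ →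
      ∫ t in Ioo 0 T, deriv φ t • v t = - ∫ t in Ioo 0 T, φ t • w t)
    {t : ℝ} (ht : t ∈ Icc 0 T) : v t = v 0 + ∫ x in 0..t, w x := by
  have hw' : IntegrableOn w (Ioo 0 T) := hw.1.mono_set Ioo_subset_Ioc_self
  have hii : ∀ {a b : ℝ}, a ∈ Icc 0 T → b ∈ Icc 0 T → IntervalIntegrable w volume a b :=
    fun ha hb => hw.mono_set (uIcc_subset_uIcc (by rwa [uIcc_of_le hT.le])
      (by rwa [uIcc_of_le hT.le]))
  -- The preceding lemma makes `D` constant on the open interval only; continuity carries this to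
  -- the endpoints.
  set D : ℝ → H := fun t => v t - ∫ x in 0..t, w x with hD
  have hDc : ContinuousOn D (Icc 0 T) := by
    refine hv.sub ?_
    have := intervalIntegral.continuousOn_primitive_interval' hw left_mem_uIcc
    rwa [uIcc_of_le hT.le] at this
  have hm : T / 2 ∈ Ioo 0 T := ⟨by linarith, by linarith⟩
  have hle : ∀ {a b : ℝ}, a ∈ Ioo 0 T → b ∈ Ioo 0 T → a ≤ b → D b = D a := by
    intro a b ha hb hab
    have h1 := sub_eq_integral_of_weak_deriv_of_mem_Ioo hv hw' h ha.1 hab hb.2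
    have h2 := intervalIntegral.integral_interval_sub_left
      (hii (left_mem_Icc.2 hT.le) (Ioo_subset_Icc_self hb))
      (hii (left_mem_Icc.2 hT.le) (Ioo_subset_Icc_self ha))
    rw [← h2] at h1
    simp only [hD]
    rw [sub_eq_sub_iff_sub_eq_sub]
    exact h1
  have hconst : EqOn D (fun _ => D (T / 2)) (Ioo 0 T) := fun x hx => by
    rcases le_total x (T / 2) with hx' | hx'
    · exact (hle hx hm hx').symm
    · exact hle hm hx hx'
  have hall : EqOn D (fun _ => D (T / 2)) (Icc 0 T) :=
    hconst.of_subset_closure hDc continuousOn_const Ioo_subset_Icc_self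
      (by rw [closure_Ioo hT.ne])
  have e := (hall ht).trans (hall (left_mem_Icc.2 hT.le)).symm
  simp only [hD, intervalIntegral.integral_same, sub_zero] at e
  rw [← e, sub_add_cancel]

end WeakDerivative

/-! ### The squared norm along a primitive -/

section Energy

variable {H : Type*} [NormedAddCommGroup H] [InnerProductSpace ℝ H] {T : ℝ}
  {v w : ℝ → H}

theorem absolutelyContinuousOnInterval_norm_sq (hT : 0 ≤ T)
    (hw : IntervalIntegrable w volume 0 T)
    (h : ∀ t ∈ Icc 0 T, v t = v 0 + ∫ x in 0..t, w x) :
    AbsolutelyContinuousOnInterval (fun t => ‖v t‖ ^ 2) 0 T := by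
  have hG := hw.norm.absolutelyContinuousOnInterval_intervalIntegral left_mem_uIcc
  have hii : ∀ {a b : ℝ}, a ∈ uIcc 0 T → b ∈ uIcc 0 T → IntervalIntegrable w volume a b :=
    fun ha hb => hw.mono_set (uIcc_subset_uIcc ha hb)
  have hN : AbsolutelyContinuousOnInterval (fun t => ‖v t‖) 0 T := by
    refine hG.of_dist_le (K := 1) fun x hx y hy => ?_
    have hx' := hx
    have hy' := hy
    rw [uIcc_of_le hT] at hx' hy'
    rw [one_mul, Real.dist_eq, Real.dist_eq]
    refine (abs_norm_sub_norm_le _ _).trans ?_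
    rw [h x hx', h y hy', add_sub_add_left_eq_sub,
      intervalIntegral.integral_interval_sub_left (hii left_mem_uIcc hx) (hii left_mem_uIcc hy),
      intervalIntegral.integral_interval_sub_left (hii left_mem_uIcc hx).norm
        (hii left_mem_uIcc hy).norm]
    exact intervalIntegral.norm_integral_le_abs_integral_norm
  simpa only [pow_two] using hN.fun_mul hN

/-- Lebesgue differentiation of the primitive, followed by the chain rule for the squared norm. -/
theorem ae_hasDerivAt_norm_sq [CompleteSpace H] (hT : 0 ≤ T) (hw : IntervalIntegrable w volume 0 T)
    (h : ∀ t ∈ Icc 0 T, v t = v 0 + ∫ x in 0..t, w x) :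
    ∀ᵐ t ∂(volume.restrict (Ioo 0 T)),
      HasDerivAt (fun t => ‖v t‖ ^ 2) (2 * inner ℝ (v t) (w t)) t := by
  rw [ae_restrict_iff' measurableSet_Ioo]
  filter_upwards [hw.ae_hasDerivAt_integral] with t ht hmem
  have h1 := ht (by rw [uIcc_of_le hT]; exact Ioo_subset_Icc_self hmem) 0 left_mem_uIcc
  have h2 : HasDerivAt v (w t) t := by
    refine (h1.const_add (v 0)).congr_of_eventuallyEq ?_
    filter_upwards [Ioo_mem_nhds hmem.1 hmem.2] with x hx
    exact h x (Ioo_subset_Icc_self hx)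
  exact h2.norm_sq

end Energy

/-! ### Extinction for the differential inequality -/

/-- Decay for the differential inequality `y' ≤ -2 c y ^ (γ + 1)` with `γ < 0`. -/
theorem le_of_deriv_le_neg_rpow {y : ℝ → ℝ} {γ c T : ℝ} (hγ : γ < 0) (hc : 0 ≤ c)
    (hy : AbsolutelyContinuousOnInterval y 0 T) (hy0 : ∀ t, 0 ≤ y t)
    (hd : ∀ᵐ t ∂(volume.restrict (Ioo 0 T)), ∃ y', HasDerivAt y y' t ∧
      y' ≤ -2 * c * (y t ^ γ * y t)) {t : ℝ} (ht : t ∈ Icc 0 T) :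
    y t ≤ (max (y 0 ^ |γ| - 2 * |γ| * c * t) 0) ^ (1 / |γ|) := by
  have hT : 0 ≤ T := ht.1.trans ht.2
  rw [abs_of_neg hγ]
  rcases (hy0 t).eq_or_lt with h0 | hpos
  · rw [← h0]
    exact Real.rpow_nonneg (le_max_right _ _) _
  have hsub : uIcc 0 t ⊆ uIcc 0 T := by
    rw [uIcc_of_le hT, uIcc_of_le ht.1]
    exact Icc_subset_Icc_right ht.2
  have hd' : ∀ᵐ s, s ∈ Ioo 0 T → ∃ y', HasDerivAt y y' s ∧ y' ≤ -2 * c * (y s ^ γ * y s) :=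
    (ae_restrict_iff' measurableSet_Ioo).1 hd
  -- The positive number `y t` is thus a lower bound for `y` on all of [0,t], so the power is only
  -- evaluated where it is smooth.
  have hanti : ∀ s ∈ Icc 0 t, y t ≤ y s := by
    intro s hs
    have hac : AbsolutelyContinuousOnInterval y s t := hy.mono ((uIcc_subset_uIcc (by
      rwa [uIcc_of_le ht.1]) right_mem_uIcc).trans hsub)
    rw [← sub_nonpos, ← hac.integral_deriv_eq_sub, intervalIntegral.integral_of_le hs.2,
      integral_Ioc_eq_integral_Ioo]
    refine setIntegral_nonpos_of_ae_restrict ?_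
    refine (ae_restrict_iff' measurableSet_Ioo).2 ?_
    filter_upwards [hd'] with r hr hmem
    obtain ⟨y', h1, h2⟩ := hr ⟨hs.1.trans_lt hmem.1, hmem.2.trans_le ht.2⟩
    rw [h1.deriv]
    have : 0 ≤ 2 * c * (y r ^ γ * y r) :=
      mul_nonneg (by positivity) (mul_nonneg (Real.rpow_nonneg (hy0 r) _) (hy0 r))
    simp only [Pi.zero_apply]
    linarith
  have hac : AbsolutelyContinuousOnInterval y 0 t := hy.mono hsub
  obtain ⟨M, hM⟩ : ∃ M, ∀ s ∈ Icc 0 t, y s ≤ M := by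
    have := (isCompact_uIcc.image_of_continuousOn hac.continuousOn).bddAbove
    rw [uIcc_of_le ht.1] at this
    obtain ⟨M, hM⟩ := this
    exact ⟨M, fun s hs => hM (mem_image_of_mem _ hs)⟩
  have hF : ContDiffOn ℝ 1 (fun r : ℝ => r ^ (-γ)) (Icc (y t) M) := fun r hr =>
    (Real.contDiffAt_rpow_const_of_ne (hpos.trans_le hr.1).ne').contDiffWithinAt
  obtain ⟨K, hK⟩ := hF.exists_lipschitzOnWith (by decide) (convex_Icc _ _) isCompact_Icc
  have hzac : AbsolutelyContinuousOnInterval (fun s => y s ^ (-γ)) 0 t := by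
    refine hac.of_dist_le (K := K) fun a ha b hb => ?_
    rw [uIcc_of_le ht.1] at ha hb
    exact hK.dist_le_mul _ ⟨hanti a ha, hM a ha⟩ _ ⟨hanti b hb, hM b hb⟩
  have hint : ∫ s in 0..t, deriv (fun s => y s ^ (-γ)) s ≤ ∫ _ in 0..t, -2 * (-γ) * c := by
    rw [intervalIntegral.integral_of_le ht.1, intervalIntegral.integral_of_le ht.1,
      integral_Ioc_eq_integral_Ioo, integral_Ioc_eq_integral_Ioo]
    have hi := hzac.intervalIntegrable_deriv.1.mono_set Ioo_subset_Ioc_self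
    refine integral_mono_ae hi (integrable_const _) ?_
    refine (ae_restrict_iff' measurableSet_Ioo).2 ?_
    filter_upwards [hd'] with r hr hmem
    obtain ⟨y', h1, h2⟩ := hr ⟨hmem.1, hmem.2.trans_le ht.2⟩
    have hyr : 0 < y r := hpos.trans_le (hanti r (Ioo_subset_Icc_self hmem))
    rw [(h1.rpow_const (p := -γ) (Or.inl hyr.ne')).deriv]
    -- The exponents cancel: this is why the power `-γ` turns the inequality into one with a
    -- constant right-hand side.
    have h3 : y r ^ γ * y r * y r ^ (-γ - 1) = 1 := by
      rw [← Real.rpow_add_one hyr.ne', ← Real.rpow_add hyr]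
      ring_nf
      exact Real.rpow_zero _
    calc y' * -γ * y r ^ (-γ - 1)
        = y' * (-γ * y r ^ (-γ - 1)) := by ring
      _ ≤ (-2 * c * (y r ^ γ * y r)) * (-γ * y r ^ (-γ - 1)) :=
          mul_le_mul_of_nonneg_right h2 (mul_nonneg (by linarith) (Real.rpow_nonneg hyr.le _))
      _ = -2 * (-γ) * c * (y r ^ γ * y r * y r ^ (-γ - 1)) := by ring
      _ = _ := by rw [h3, mul_one]
  rw [hzac.integral_deriv_eq_sub, intervalIntegral.integral_const, smul_eq_mul, sub_zero] at hint
  have hle : y t ^ (-γ) ≤ max (y 0 ^ (-γ) - 2 * -γ * c * t) 0 :=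
    le_max_of_le_left (by linarith)
  calc y t = (y t ^ (-γ)) ^ (1 / -γ) := by
        rw [← Real.rpow_mul (hy0 t), mul_one_div_cancel (by linarith), Real.rpow_one]
    _ ≤ _ := Real.rpow_le_rpow (Real.rpow_nonneg (hy0 t) _) hle (by
        have : 0 < -γ := by linarith
        positivity)

/-! ### Energy inequality and conclusion -/

/-- Testing the homogeneous equation with the solution itself. -/
theorem two_mul_inner_le_of_weak_equation (hd : 1 ≤ d) (hΩb : Bornology.IsBounded Ω) {γ : ℝ}
    {v : H1 Ω} (hv : v ∈ H10 Ω) {w : L2 Ω}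
    (h : (∫ x in Ω, w x * toL2 v x) + (∫ x in Ω, toL2 v x ^ 2) ^ γ *
      ∫ x in Ω, inner ℝ (weakGrad v x) (weakGrad v x) = ∫ x in Ω, (0 : L2 Ω) x * toL2 v x) :
    2 * inner ℝ (toL2 v) w ≤
      -2 * poincareConstant Ω * ((‖toL2 v‖ ^ 2) ^ γ * ‖toL2 v‖ ^ 2) := by
  have h0 : ∫ x in Ω, (0 : L2 Ω) x * toL2 v x = 0 := by
    rw [← integral_zero (E d) ℝ (μ := volume.restrict Ω)]
    refine integral_congr_ae ?_
    filter_upwards [Lp.coeFn_zero ℝ 2 (volume.restrict Ω)] with x hx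
    rw [hx, Pi.zero_apply, zero_mul]
  have h1 : ∫ x in Ω, w x * toL2 v x = inner ℝ (toL2 v) w := by
    rw [L2.inner_def]
    rfl
  have hP := poincareConstant_mul_le hd hΩb hv
  simp only [real_inner_self_eq_norm_sq] at h
  rw [h0, h1] at h
  rw [integral_sq_eq_norm_sq] at h hP
  -- Only nonnegativity of the coefficient matters, so the default value of `0 ^ γ` needs no
  -- separate case.
  have hnn : 0 ≤ (‖toL2 v‖ ^ 2) ^ γ := Real.rpow_nonneg (sq_nonneg _) _
  have := mul_le_mul_of_nonneg_left hP hnn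
  linarith

theorem IsWeakTimeDeriv.congr_ae {T : ℝ} {u v u' : ℝ → L2 Ω} (h : IsWeakTimeDeriv T u u')
    (huv : ∀ᵐ t ∂(volume.restrict (Ioo 0 T)), v t = u t) : IsWeakTimeDeriv T v u' := by
  intro φ hφ
  rw [← h φ hφ]
  exact integral_congr_ae (huv.mono fun t ht => congrArg (deriv φ t • ·) ht)

theorem intervalIntegrable_of_memLp_two {H : Type*} [NormedAddCommGroup H] {T : ℝ} (hT : 0 ≤ T)
    {w : ℝ → H} (hw : MemLp w 2 (volume.restrict (Ioo 0 T))) :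
    IntervalIntegrable w volume 0 T :=
  (intervalIntegrable_iff_integrableOn_Ioo_of_le hT).2 (hw.integrable (by norm_num))

end NonlocalHeat

theorem mainTheorem5 {d : ℕ} (hd : 1 ≤ d) (Ω : Set (NonlocalHeat.E d)) (hΩ : IsOpen Ω)
    (hΩb : Bornology.IsBounded Ω) (hΩn : Ω.Nonempty) (γ : ℝ) (hγ : γ < 0) (T : ℝ) (hT : 0 < T)
    (u₀ : NonlocalHeat.E d → ℝ) (u : ℝ → NonlocalHeat.H1 Ω)
    (hu : NonlocalHeat.IsWeakSolution Ω γ T (fun _ => 0) u₀ u) :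
    0 < NonlocalHeat.poincareConstant Ω ∧
    ∃ ubar : ℝ → NonlocalHeat.L2 Ω, NonlocalHeat.IsContinuousRepresentative T u ubar ∧
      ubar 0 =ᵐ[volume.restrict Ω] u₀ ∧
      ∀ t ∈ Icc 0 T,
        (∫ x in Ω, (ubar t x) ^ 2 ≤
          (max ((∫ x in Ω, (u₀ x) ^ 2) ^ |γ| - 2 * |γ| * NonlocalHeat.poincareConstant Ω * t) 0)
            ^ (1 / |γ|)) ∧
        ((∫ x in Ω, (u₀ x) ^ 2) ^ |γ| / (2 * |γ| * NonlocalHeat.poincareConstant Ω) ≤ t →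
          ubar t = 0) := by
  have hC : 0 < NonlocalHeat.poincareConstant Ω :=
    NonlocalHeat.poincareConstant_pos hd hΩ hΩb hΩn
  obtain ⟨ubar, hrep, hinit⟩ := hu.initial
  obtain ⟨u', hu', hwd, heq⟩ := hu.equation
  have hw := NonlocalHeat.intervalIntegrable_of_memLp_two hT.le hu'
  have hprim : ∀ t ∈ Icc 0 T, ubar t = ubar 0 + ∫ x in 0..t, u' x := fun t ht =>
    NonlocalHeat.eq_add_integral_of_weak_deriv hT hrep.continuousOn hw
      (hwd.congr_ae hrep.ae_eq) ht
  have hdec : ∀ᵐ t ∂(volume.restrict (Ioo 0 T)), ∃ y', HasDerivAt (fun t => ‖ubar t‖ ^ 2) y' t ∧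
      y' ≤ -2 * NonlocalHeat.poincareConstant Ω * ((‖ubar t‖ ^ 2) ^ γ * ‖ubar t‖ ^ 2) := by
    filter_upwards [NonlocalHeat.ae_hasDerivAt_norm_sq hT.le hw hprim, hrep.ae_eq, hu.boundary,
      heq] with t h1 h2 h3 h4
    -- The derivative is known for `ubar`, the equation for `u`; they agree at a.e. time, and `u t`
    -- is an admissible test function there.
    refine ⟨_, h1, ?_⟩
    rw [h2]
    exact NonlocalHeat.two_mul_inner_le_of_weak_equation hd hΩb h3 (h4 _ h3)
  have hu₀ : ∫ x in Ω, (u₀ x) ^ 2 = ‖ubar 0‖ ^ 2 := by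
    rw [← NonlocalHeat.integral_sq_eq_norm_sq]
    exact integral_congr_ae (hinit.mono fun x hx => congrArg (· ^ 2) hx.symm)
  refine ⟨hC, ubar, hrep, hinit, fun t ht => ?_⟩
  have hmain := NonlocalHeat.le_of_deriv_le_neg_rpow hγ hC.le
    (NonlocalHeat.absolutelyContinuousOnInterval_norm_sq hT.le hw hprim)
    (fun t => sq_nonneg ‖ubar t‖) hdec ht
  rw [hu₀, NonlocalHeat.integral_sq_eq_norm_sq]
  refine ⟨hmain, fun hle => ?_⟩
  have hγ' : 0 < |γ| := abs_pos.2 hγ.ne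
  rw [div_le_iff₀ (by positivity)] at hle
  -- Past the extinction time the bracket is nonpositive, and 0 to the positive power 1/|γ| is 0.
  rw [max_eq_right (by linarith), Real.zero_rpow (by positivity)] at hmain
  exact norm_eq_zero.1 (pow_eq_zero_iff two_ne_zero |>.1 (le_antisymm hmain (sq_nonneg _)))
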